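/- Let $G$ be a finite directed graph (loops and multiple edges allowed) with vertex set $\mathcal V$ and edge set $\mathcal E$, and let $s(e)$ and $r(e)$ be the initial and final vertex of $e\in\mathcal E$. Let $\mathcal E^-=\{e^-: e\in\mathcal E\}$ and $\mathcal E^+=\{e^+: e\in\mathcal E\}$ be two disjoint copies of $\mathcal E$. The graph inverse semigroup of $G$ is the semigroup with zero generated by $\mathcal E^-\cup\{P_v: v\in\mathcal V\}\cup\mathcal E^+$ with the relations $$P_uP_u=P_u,\qquad P_uP_w=0\ (u\neq w),$$ $$P_{s(e)}e^-=e^-=e^-P_{r(e)},\qquad P_{r(e)}e^+=e^+=e^+P_{s(e)},$$ $$f^-f^+=P_{s(f)},\qquad f^-g^+=0\ (f\neq g),\qquad g^+f^-=0\ (s(f)\neq s(g)),$$ $$f^-g^-=0\ (r(f)\neq s(g)),\qquad g^+f^+=0\ (r(f)\neq s(g)).$$ The Markov-Dyck shift $D_G\subset(\mathcal E^-\cup\mathcal E^+)^{\mathbb Z}$ is the subshift of all bi-infinite sequences all of whose finite subwords have a non-zero product in this semigroup. The topological entropy of a subshift $X$ is $h(X)=\lim_{n\to\infty}\frac1n\log\operatorname{card}\mathcal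 L_n(X)$, where $\mathcal L_n(X)$ is the set of words of length $n$ that appear in points of $X$. Let $a\ge 1$ be an integer, and let $D_{F(a,1,a)}$ be the Markov-Dyck shift of a directed graph with two vertices and adjacency matrix $F(a,1,a)=\begin{bmatrix} a & 1\\ a & 0\end{bmatrix}$ (the entry at $(u,v)$ is the number of edges from $u$ to $v$). Then the limit defining $h(D_{F(a,1,a)})$ exists, and $$h(D_{F(a,1,a)})=\log(a+1)-\log(a+2)+\log(a+3).$$ In particular, for $a=1$ (the Fibonacci-Dyck shift), $h(D_{F(1,1,1)})=3\log 2-\log 3$. -/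

import Mathlib

open Filter Topology

namespace MarkovDyck

/-! ### Subshifts over `ℤ` and their topological entropy -/

/-- Subshifts of `A ^ ℤ`: closed sets invariant under all translations
`x ↦ (i ↦ x (g + i))`, `g ∈ ℤ`. -/
abbrev ZSubshift (A : Type*) [TopologicalSpace A] := SymbolicDynamics.FullShift.Subshift A ℤ

/-- `ℒ_n(X)`: the set of words of length `n` that appear somewhere in a point of `X`. -/
def language {A : Type*} [TopologicalSpace A] (X : ZSubshift A) (n : ℕ) : Set (Fin n → A) :=
  {w | ∃ x ∈ X.carrier, ∃ i : ℤ, ∀ k : Fin n, x (i + (k : ℤ)) = w k}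

/-- `HasEntropy X h`: the limit `lim_{n → ∞} (1 / n) log (card ℒ_n(X))` exists and equals `h`,
that is, the subshift `X` over a finite alphabet has topological entropy `h`. -/
def HasEntropy {A : Type*} [TopologicalSpace A] [Finite A] (X : ZSubshift A) (h : ℝ) : Prop :=
  Tendsto (fun n : ℕ => 1 / (n : ℝ) * Real.log ((language X n).ncard : ℝ)) atTop (𝓝 h)

/-! ### Directed graphs -/

/-- A directed graph with vertex set `V` and edge set `E`; loops and multiple edges are allowed. -/
structure DirectedGraph (V E : Type*) where
  /-- the initial vertex of an edge -/
  s : E → V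
  /-- the final vertex of an edge -/
  r : E → V

/-- The adjacency matrix: the entry at `(u, v)` is the number of edges from `u` to `v`. -/
noncomputable def DirectedGraph.adjacency {V E : Type*} (G : DirectedGraph V E) :
    Matrix V V ℕ :=
  Matrix.of fun u v => Nat.card {e : E // G.s e = u ∧ G.r e = v}

/-- The matrix `F(a,b,c)`. -/
def F (a b c : ℕ) : Matrix (Fin 2) (Fin 2) ℕ :=
  !![a, b; c, 0]

/-! ### The graph inverse semigroup -/

/-- The alphabet `ℰ⁻ ∪ ℰ⁺`: two copies `e⁻`, `e⁺` of every edge `e`. -/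
inductive Letter (E : Type*) : Type _
  | neg (e : E) : Letter E
  | pos (e : E) : Letter E

instance {E : Type*} : TopologicalSpace (Letter E) := ⊥

instance {E : Type*} : DiscreteTopology (Letter E) := ⟨rfl⟩

instance {E : Type*} [Finite E] : Finite (Letter E) :=
  Finite.of_surjective (fun x : E ⊕ E => Sum.elim Letter.neg Letter.pos x) (by
    rintro (e | e)
    · exact ⟨Sum.inl e, rfl⟩
    · exact ⟨Sum.inr e, rfl⟩)

/-- The generators of the graph inverse semigroup: the idempotents `P_v`, the letters `e⁻` and
`e⁺`, and the zero element. -/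
inductive Gen (V E : Type*) : Type _
  | zero : Gen V E
  | idem (v : V) : Gen V E
  | letter (l : Letter E) : Gen V E

section Relations

variable {V E : Type*}

/-- The zero as a word in the generators. -/
def wZero : FreeMonoid (Gen V E) := FreeMonoid.of Gen.zero

/-- `P_v` as a word in the generators. -/
def wIdem (v : V) : FreeMonoid (Gen V E) := FreeMonoid.of (Gen.idem v)

/-- `e⁻` as a word in the generators. -/
def wNeg (e : E) : FreeMonoid (Gen V E) := FreeMonoid.of (Gen.letter (Letter.neg e))

/-- `e⁺` as a word in the generators. -/
def wPos (e : E) : FreeMonoid (Gen V E) := FreeMonoid.of (Gen.letter (Letter.pos e))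

/-- The defining relations of the graph inverse semigroup of `G`. The letter `e⁻` is an arrow from
`s e` to `r e`, the letter `e⁺` is an arrow from `r e` to `s e`. -/
inductive Rel (G : DirectedGraph V E) : FreeMonoid (Gen V E) → FreeMonoid (Gen V E) → Prop
  | zero_mul (x : Gen V E) : Rel G (wZero * FreeMonoid.of x) wZero
  | mul_zero (x : Gen V E) : Rel G (FreeMonoid.of x * wZero) wZero
  | idem_self (u : V) : Rel G (wIdem u * wIdem u) (wIdem u)
  | idem_ne (u w : V) : u ≠ w → Rel G (wIdem u * wIdem w) wZero
  | source_neg (e : E) : Rel G (wIdem (G.s e) * wNeg e) (wNeg e)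
  | neg_range (e : E) : Rel G (wNeg e * wIdem (G.r e)) (wNeg e)
  | range_pos (e : E) : Rel G (wIdem (G.r e) * wPos e) (wPos e)
  | pos_source (e : E) : Rel G (wPos e * wIdem (G.s e)) (wPos e)
  | neg_pos_self (f : E) : Rel G (wNeg f * wPos f) (wIdem (G.s f))
  | neg_pos_ne (f g : E) : f ≠ g → Rel G (wNeg f * wPos g) wZero
  | pos_neg (f g : E) : G.s f ≠ G.s g → Rel G (wPos g * wNeg f) wZero
  | neg_neg (f g : E) : G.r f ≠ G.s g → Rel G (wNeg f * wNeg g) wZero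
  | pos_pos (f g : E) : G.r f ≠ G.s g → Rel G (wPos g * wPos f) wZero

end Relations

/-- The graph inverse semigroup of `G`, given by generators and relations. An identity (the empty
word) is adjoined, so that the product of the empty word makes sense; since both sides of every
relation are non-empty, this does not change the products of non-empty words. -/
abbrev GraphInverseSemigroup {V E : Type*} (G : DirectedGraph V E) :=
  PresentedMonoid (Rel G)

/-- The zero of the graph inverse semigroup. -/
def gisZero {V E : Type*} (G : DirectedGraph V E) : GraphInverseSemigroup G :=
  PresentedMonoid.of (Rel G) Gen.zero

/-- The product `∏ e_k` of a word in the letters `e⁻`, `e⁺`. -/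
def wordProd {V E : Type*} (G : DirectedGraph V E) (w : List (Letter E)) :
    GraphInverseSemigroup G :=
  (w.map fun l => PresentedMonoid.of (Rel G) (Gen.letter l)).prod

/-- A word is admissible if its product in the graph inverse semigroup is not zero. -/
def Admissible {V E : Type*} (G : DirectedGraph V E) (w : List (Letter E)) : Prop :=
  wordProd G w ≠ gisZero G

/-! ### Markov-Dyck shifts -/

/-- The word `x_i x_{i+1} … x_{i+n-1}`. -/
def window {A : Type*} (x : ℤ → A) (i : ℤ) (n : ℕ) : List A :=
  List.ofFn fun k : Fin n => x (i + (k : ℤ))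

/-- The Markov-Dyck shift `D_G`: the points all of whose finite subwords have a non-zero
product in the graph inverse semigroup of `G`. -/
def shift {V E : Type*} (G : DirectedGraph V E) : ZSubshift (Letter E) where
  carrier := {x | ∀ (i : ℤ) (n : ℕ), Admissible G (window x i n)}
  isClosed := by
    have h : {x : ℤ → Letter E | ∀ (i : ℤ) (n : ℕ), Admissible G (window x i n)} =
        ⋂ (i : ℤ) (n : ℕ), (fun (x : ℤ → Letter E) (k : Fin n) => x (i + (k : ℤ))) ⁻¹'
          {w : Fin n → Letter E | Admissible G (List.ofFn w)} := by
      ext x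
      simp [window]
    rw [h]
    refine isClosed_iInter fun i => isClosed_iInter fun n => ?_
    exact (isClosed_discrete _).preimage (by fun_prop)
  mapsTo := by
    intro g x hx i n
    have h := hx (g + i) n
    simpa [window, add_assoc] using h

end MarkovDyck

namespace MarkovDyck

/-! ### The stack machine -/

/-! A word is read by a stack machine: `e⁻` pushes `e`, `e⁺` pops it or, on an empty stack, moves
the base vertex. A non-empty word with non-zero product has a run from some base vertex, and any run
forces a non-zero product (`exists_run_base_ne_none`, `Stack.admissible_of_run_ne_none`). Hence the
entropy is the growth rate of the number of runs.

Runs are counted with a positive function `H` on stacks. If the sum of `H` over the successors of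
every valid stack is at least (at most) `c * H`, then so is its iterate with `c ^ n`, and bounds on
`H` turn this into bounds on the number of runs. The affine recursion `H(S e) = w_{r(e)} + p_{r(e)}
H(S)` gives exact equality on non-empty stacks once `∑_{s(e)=v} p_{r(e)} + 1 / p_v = c` and `w` is
fixed by the adjacency matrix with rows scaled by `p`. Only the boundary values on empty stacks
differ: `w` gives the lower bound `m * c ^ n`, and a left eigenvector `θ`, with `w` shrunk to `w /
n`, gives the upper bound `M * n * (c + K / n) ^ n`. Both have exponential rate `log c`. For
`F(a,1,a)` all these data are explicit. -/

/-- Stacks of edges over a base vertex. -/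
inductive Stack (V E : Type*) : Type _
  | base (v : V) : Stack V E
  | push (S : Stack V E) (e : E) : Stack V E

namespace Stack

variable {V E : Type*}

/-- The current vertex of a stack. -/
def top (G : DirectedGraph V E) : Stack V E → V
  | base v => v
  | push _ e => G.r e

/-- The edges of the stack form a path that starts at the base vertex. -/
def Valid (G : DirectedGraph V E) : Stack V E → Prop
  | base _ => True
  | push S e => G.s e = S.top G ∧ S.Valid G

/-- The letter `e⁻` pushes `e`, the letter `e⁺` removes `e` from the top of the stack, and moves the
base vertex if there is nothing to remove. -/
def step [DecidableEq V] [DecidableEq E] (G : DirectedGraph V E) :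
    Stack V E → Letter E → Option (Stack V E)
  | S, .neg e => if G.s e = S.top G then some (push S e) else none
  | base v, .pos e => if G.r e = v then some (base (G.s e)) else none
  -- The condition on `S.top` is automatic on valid stacks. It makes the defining relations hold on
  -- all stacks, so that the representation needs no subtype.
  | push S f, .pos e => if f = e ∧ G.s f = S.top G then some S else none

variable [DecidableEq V] [DecidableEq E] (G : DirectedGraph V E)

theorem step_neg (S : Stack V E) (e : E) :
    S.step G (.neg e) = if G.s e = S.top G then some (push S e) else none := by
  cases S <;> rfl

theorem top_of_step_pos {S T : Stack V E} {e : E} (h : S.step G (.pos e) = some T) :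
    S.top G = G.r e ∧ T.top G = G.s e := by
  cases S with
  | base v =>
    simp only [step, Option.ite_none_right_eq_some, Option.some.injEq] at h
    obtain ⟨h, rfl⟩ := h
    exact ⟨h.symm, rfl⟩
  | push S f =>
    simp only [step, Option.ite_none_right_eq_some, Option.some.injEq] at h
    obtain ⟨⟨rfl, h⟩, rfl⟩ := h
    exact ⟨rfl, h.symm⟩

theorem Valid.step {S T : Stack V E} {l : Letter E} (hS : S.Valid G) (h : S.step G l = some T) :
    T.Valid G := by
  cases l with
  | neg e =>
    simp only [step_neg, Option.ite_none_right_eq_some, Option.some.injEq] at h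
    obtain ⟨h, rfl⟩ := h
    exact ⟨h, hS⟩
  | pos e =>
    cases S with
    | base v =>
      simp only [Stack.step, Option.ite_none_right_eq_some, Option.some.injEq] at h
      obtain ⟨h, rfl⟩ := h
      trivial
    | push S f =>
      simp only [Stack.step, Option.ite_none_right_eq_some, Option.some.injEq] at h
      obtain ⟨⟨rfl, h⟩, rfl⟩ := h
      exact hS.2

/-- The action of a generator of the graph inverse semigroup on stacks. -/
def genStep : Gen V E → Stack V E → Option (Stack V E)
  | .zero, _ => none
  | .idem v, S => if S.top G = v then some S else none
  | .letter l, S => S.step G l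

/-- The action of a generator as a self-map of `Option (Stack V E)`, in the opposite monoid. -/
def genEnd (x : Gen V E) : (Function.End (Option (Stack V E)))ᵐᵒᵖ :=
  MulOpposite.op fun o => o.bind (genStep G x)

/-- Passing to the opposite monoid makes a product act from left to right, in the order in which
words are read. -/
theorem unop_genEnd_mul (x y : Gen V E) (o : Option (Stack V E)) :
    (genEnd G x * genEnd G y).unop o = (o.bind (genStep G x)).bind (genStep G y) := rfl

theorem unop_genEnd (x : Gen V E) (o : Option (Stack V E)) :
    (genEnd G x).unop o = o.bind (genStep G x) := rfl

theorem genEnd_rel {x y : FreeMonoid (Gen V E)} (h : Rel G x y) :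
    FreeMonoid.lift (genEnd G) x = FreeMonoid.lift (genEnd G) y := by
  refine MulOpposite.unop_injective (funext fun o => ?_)
  cases h <;>
    simp only [wZero, wIdem, wNeg, wPos, map_mul, FreeMonoid.lift_eval_of, unop_genEnd_mul,
      unop_genEnd, Option.bind_assoc] <;>
    (refine Option.bind_congr fun S hS => ?_; clear hS)
  case zero_mul x => rfl
  case mul_zero x => simp [genStep]
  case idem_self u => by_cases h : S.top G = u <;> simp [genStep, h]
  case idem_ne u w h =>
    by_cases h' : S.top G = u
    · simp [genStep, h', h]
    · simp [genStep, h']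
  case source_neg e =>
    by_cases h : S.top G = G.s e
    · simp [genStep, h]
    · simp [genStep, h, step_neg, Ne.symm h]
  case neg_range e => 
    by_cases h : G.s e = S.top G
    · simp [genStep, h, step_neg, top]
    · simp [genStep, h, step_neg]
  case range_pos e =>
    by_cases h : S.top G = G.r e
    · simp [genStep, h]
    · have : S.step G (.pos e) = none := by
        by_contra h'
        obtain ⟨T, hT⟩ := Option.ne_none_iff_exists'.1 h'
        exact h (top_of_step_pos G hT).1
      simp [genStep, h, this]
  case pos_source e =>
    simp only [genStep]
    cases h : S.step G (.pos e) with
    | none => rfl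
    | some T => simp [genStep, (top_of_step_pos G h).2]
  case neg_pos_self f =>
    by_cases h : G.s f = S.top G
    · simp [genStep, h, step]
    · simp [genStep, step_neg, h, Ne.symm h]
  case neg_pos_ne f g hfg =>
    by_cases h : G.s f = S.top G <;> simp [genStep, h, step, hfg]
  case pos_neg f g hfg =>
    simp only [genStep]
    cases h : S.step G (.pos g) with
    | none => rfl
    | some T => simp [genStep, step_neg, (top_of_step_pos G h).2, hfg]
  case neg_neg f g hfg =>
    by_cases h : G.s f = S.top G
    · simp [genStep, step_neg, h, top, Ne.symm hfg]
    · simp [genStep, step_neg, h]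
  case pos_pos f g hfg =>
    simp only [genStep]
    cases h : S.step G (.pos g) with
    | none => rfl
    | some T =>
      by_contra h'
      obtain ⟨U, hU⟩ := Option.ne_none_iff_exists'.1 h'
      exact hfg ((top_of_step_pos G hU).1.symm.trans (top_of_step_pos G h).2)

/-- The representation of the graph inverse semigroup by partial maps of stacks. -/
def rep : GraphInverseSemigroup G →* (Function.End (Option (Stack V E)))ᵐᵒᵖ :=
  PresentedMonoid.lift (genEnd G) fun _ _ h => genEnd_rel G h

/-- The run of the stack machine on a word. -/
def run (S : Stack V E) (w : List (Letter E)) : Option (Stack V E) :=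
  w.foldlM (step G) S

@[simp] theorem run_nil (S : Stack V E) : S.run G [] = some S := rfl

@[simp] theorem run_cons (S : Stack V E) (l : Letter E) (w : List (Letter E)) :
    S.run G (l :: w) = (S.step G l).bind fun T => T.run G w := rfl

theorem run_append (S : Stack V E) (u w : List (Letter E)) :
    S.run G (u ++ w) = (S.run G u).bind fun T => T.run G w :=
  List.foldlM_append

theorem rep_wordProd (w : List (Letter E)) (S : Stack V E) :
    (rep G (wordProd G w)).unop (some S) = S.run G w := by
  induction w generalizing S with
  | nil => simp [wordProd]; rfl
  | cons l w ih =>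
    have h : wordProd G (l :: w) = PresentedMonoid.of (Rel G) (Gen.letter l) * wordProd G w := by
      simp [wordProd]
    have h' : rep G (PresentedMonoid.of (Rel G) (Gen.letter l)) = genEnd G (Gen.letter l) :=
      PresentedMonoid.lift_of ..
    rw [h, map_mul, h', run_cons]
    change (rep G (wordProd G w)).unop (S.step G l) = _
    cases S.step G l with
    | none =>
      -- A run that has died stays dead: every element of the semigroup fixes `none`.
      have key : ∀ x : GraphInverseSemigroup G, (rep G x).unop none = none := by
        intro x
        induction x using PresentedMonoid.inductionOn with
        | _ y =>
        induction y using FreeMonoid.inductionOn' with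
        | one => rfl
        | of_mul a y ih =>
          rw [map_mul, map_mul]
          exact ih
      exact key _
    | some T => exact ih T

/-- The zero is represented by the nowhere defined map, so one surviving run separates a product
from zero. -/
theorem admissible_of_run_ne_none {S : Stack V E} {w : List (Letter E)} (h : S.run G w ≠ none) :
    Admissible G w := by
  intro h0
  apply h
  rw [← rep_wordProd, h0]
  have h' : rep G (gisZero G) = genEnd G Gen.zero := PresentedMonoid.lift_of ..
  rw [h']
  rfl

end Stack

/-! ### Computing products in the graph inverse semigroup -/

section Products

variable {V E : Type*} (G : DirectedGraph V E)

theorem wordProd_append (u w : List (Letter E)) :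
    wordProd G (u ++ w) = wordProd G u * wordProd G w := by
  simp [wordProd]

theorem mk_eq_of_rel {x y : FreeMonoid (Gen V E)} (h : Rel G x y) :
    PresentedMonoid.mk (Rel G) x = PresentedMonoid.mk (Rel G) y :=
  PresentedMonoid.mk_eq_mk_of_rel h

theorem gisZero_mul (x : GraphInverseSemigroup G) : gisZero G * x = gisZero G := by
  induction x using PresentedMonoid.inductionOn with
  | _ y =>
  induction y using FreeMonoid.inductionOn' with
  | one => exact mul_one _
  | of_mul a y ih =>
    rw [map_mul, ← mul_assoc]
    exact (congrArg (· * _) (mk_eq_of_rel G (.zero_mul a))).trans ih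

theorem mul_gisZero (x : GraphInverseSemigroup G) : x * gisZero G = gisZero G := by
  induction x using PresentedMonoid.inductionOn with
  | _ y =>
  induction y using FreeMonoid.inductionOn' with
  | one => exact one_mul _
  | of_mul a y ih =>
    rw [map_mul, mul_assoc, ih]
    exact mk_eq_of_rel G (.mul_zero a)

theorem Admissible.of_append {u w t : List (Letter E)} (h : Admissible G (u ++ (w ++ t))) :
    Admissible G w := by
  intro h0
  apply h
  rw [wordProd_append, wordProd_append, h0, gisZero_mul, mul_gisZero]

/-- The idempotent `P_v` in the graph inverse semigroup. -/
def gisIdem (v : V) : GraphInverseSemigroup G := PresentedMonoid.of (Rel G) (Gen.idem v)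

/-- A letter in the graph inverse semigroup. -/
def gisLetter (l : Letter E) : GraphInverseSemigroup G := PresentedMonoid.of (Rel G) (Gen.letter l)

theorem wordProd_cons (l : Letter E) (w : List (Letter E)) :
    wordProd G (l :: w) = gisLetter G l * wordProd G w := by
  simp [wordProd, gisLetter]

/-- The product `P_v e₁⁻ ⋯ e_k⁻` of a stack. -/
def Stack.prod : Stack V E → GraphInverseSemigroup G
  | .base v => gisIdem G v
  | .push S e => S.prod * gisLetter G (.neg e)

theorem Stack.prod_mul_top (S : Stack V E) : S.prod G * gisIdem G (S.top G) = S.prod G := by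
  cases S with
  | base v => exact mk_eq_of_rel G (.idem_self v)
  | push S e =>
    rw [Stack.prod, mul_assoc]
    exact congrArg (_ * ·) (mk_eq_of_rel G (.neg_range e))

theorem Stack.prod_mul_idem {S : Stack V E} {v : V} (h : v ≠ S.top G) :
    S.prod G * gisIdem G v = gisZero G := by
  rw [← S.prod_mul_top, mul_assoc]
  exact (congrArg (_ * ·) (mk_eq_of_rel G (.idem_ne _ _ h.symm))).trans (mul_gisZero G _)

/-- Each machine step is a rewriting by the relations. A pop on an empty stack uses `P_v e⁺ = e⁺
P_{s(e)}`, which leaves a factor `e⁺` on the left; it is harmless because only vanishing is at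
stake. -/
theorem Stack.prod_mul_wordProd [DecidableEq V] [DecidableEq E] {S : Stack V E}
    {w : List (Letter E)} (h : S.run G w = none) : S.prod G * wordProd G w = gisZero G := by
  induction w generalizing S with
  | nil => simp at h
  | cons l w ih =>
    rw [run_cons] at h
    rw [wordProd_cons, ← mul_assoc]
    cases l with
    | neg e =>
      by_cases he : G.s e = S.top G
      · simp only [step_neg, he, if_true, Option.bind_some] at h
        exact ih h
      · have h1 : gisLetter G (.neg e) = gisIdem G (G.s e) * gisLetter G (.neg e) :=
          (mk_eq_of_rel G (.source_neg e)).symm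
        rw [h1, ← mul_assoc, prod_mul_idem G he, gisZero_mul, gisZero_mul]
    | pos e =>
      cases S with
      | base v =>
        by_cases he : G.r e = v
        · simp only [step, he, if_true, Option.bind_some] at h
          have h1 : gisIdem G v * gisLetter G (.pos e) =
              gisLetter G (.pos e) * gisIdem G (G.s e) :=
            he ▸ (mk_eq_of_rel G (.range_pos e)).trans (mk_eq_of_rel G (.pos_source e)).symm
          rw [Stack.prod, h1, mul_assoc]
          exact (congrArg (_ * ·) (ih h)).trans (mul_gisZero G _)
        · have h1 : gisLetter G (.pos e) = gisIdem G (G.r e) * gisLetter G (.pos e) :=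
            (mk_eq_of_rel G (.range_pos e)).symm
          rw [h1, ← mul_assoc, prod_mul_idem G he, gisZero_mul, gisZero_mul]
      | push S f =>
        rw [Stack.prod, mul_assoc (S.prod G)]
        by_cases hf : f = e
        · subst hf
          have h1 : gisLetter G (.neg f) * gisLetter G (.pos f) = gisIdem G (G.s f) :=
            mk_eq_of_rel G (.neg_pos_self f)
          rw [h1]
          by_cases hs : G.s f = S.top G
          · simp only [step, hs, true_and, if_true, Option.bind_some] at h
            rw [hs, prod_mul_top, ih h]
          · rw [prod_mul_idem G hs, gisZero_mul]
        · have h1 : gisLetter G (.neg f) * gisLetter G (.pos e) = gisZero G :=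
            mk_eq_of_rel G (.neg_pos_ne f e hf)
          rw [h1, mul_gisZero, gisZero_mul]

/-- The first letter absorbs an idempotent `P_v` on its left, so the word has the same product as
the empty stack at `v` followed by the word. -/
theorem exists_run_base_ne_none [DecidableEq V] [DecidableEq E] {w : List (Letter E)}
    (hw : w ≠ []) (h : Admissible G w) : ∃ v, (Stack.base v).run G w ≠ none := by
  obtain ⟨l, w, rfl⟩ := List.exists_cons_of_ne_nil hw
  have h1 : ∃ v, gisIdem G v * gisLetter G l = gisLetter G l := by
    cases l with
    | neg e => exact ⟨_, mk_eq_of_rel G (.source_neg e)⟩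
    | pos e => exact ⟨_, mk_eq_of_rel G (.range_pos e)⟩
  obtain ⟨v, hv⟩ := h1
  refine ⟨v, fun h0 => h ?_⟩
  rw [← Stack.prod_mul_wordProd G h0, wordProd_cons, ← mul_assoc]
  exact congrArg (· * _) hv.symm

end Products

end MarkovDyck

namespace MarkovDyck

/-! ### Counting the runs of a partial automaton -/

section Counting

variable {L σ : Type*} [Fintype L] (f : σ → L → Option σ)

/-- The sum of a weight of the final state over all successful runs of length `n`. -/
def runSum (H : σ → ℝ) (n : ℕ) (s : σ) : ℝ :=
  ∑ w : Fin n → L, ((List.ofFn w).foldlM f s).elim 0 H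

theorem runSum_zero (H : σ → ℝ) (s : σ) : runSum f H 0 s = H s := by
  simp [runSum]

theorem runSum_succ (H : σ → ℝ) (n : ℕ) (s : σ) :
    runSum f H (n + 1) s = ∑ l, (f s l).elim 0 (runSum f H n) := by
  rw [runSum, ← (Fin.consEquiv fun _ => L).sum_comp, Fintype.sum_prod_type]
  refine Finset.sum_congr rfl fun l _ => ?_
  simp only [Fin.consEquiv, Equiv.coe_fn_mk, List.ofFn_cons, List.foldlM_cons]
  cases f s l <;> simp [runSum]

/-- Iteration of a superharmonic inequality. The invariant `I` is needed because for stacks the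
inequality is only available on valid ones. -/
theorem runSum_le {I : σ → Prop} (hI : ∀ s t l, I s → f s l = some t → I t) {H : σ → ℝ} {c : ℝ}
    (hc : 0 ≤ c) (hH : ∀ s, I s → ∑ l, (f s l).elim 0 H ≤ c * H s) (n : ℕ) {s : σ} (hs : I s) :
    runSum f H n s ≤ c ^ n * H s := by
  induction n generalizing s with
  | zero => simp [runSum_zero]
  | succ n ih =>
    rw [runSum_succ]
    calc ∑ l, (f s l).elim 0 (runSum f H n) ≤ ∑ l, c ^ n * (f s l).elim 0 H := by
          refine Finset.sum_le_sum fun l _ => ?_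
          cases h : f s l with
          | none => simp
          | some t => exact ih (hI _ _ _ hs h)
      _ ≤ c ^ n * (c * H s) := by
          rw [← Finset.mul_sum]
          exact mul_le_mul_of_nonneg_left (hH s hs) (pow_nonneg hc n)
      _ = c ^ (n + 1) * H s := by ring

theorem le_runSum {I : σ → Prop} (hI : ∀ s t l, I s → f s l = some t → I t) {H : σ → ℝ} {c : ℝ}
    (hc : 0 ≤ c) (hH : ∀ s, I s → c * H s ≤ ∑ l, (f s l).elim 0 H) (n : ℕ) {s : σ} (hs : I s) :
    c ^ n * H s ≤ runSum f H n s := by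
  induction n generalizing s with
  | zero => simp [runSum_zero]
  | succ n ih =>
    rw [runSum_succ]
    calc c ^ (n + 1) * H s = c ^ n * (c * H s) := by ring
      _ ≤ ∑ l, c ^ n * (f s l).elim 0 H := by
          rw [← Finset.mul_sum]
          exact mul_le_mul_of_nonneg_left (hH s hs) (pow_nonneg hc n)
      _ ≤ ∑ l, (f s l).elim 0 (runSum f H n) := by
          refine Finset.sum_le_sum fun l _ => ?_
          cases h : f s l with
          | none => simp
          | some t => exact ih (hI _ _ _ hs h)

theorem mul_ncard_le_runSum {H : σ → ℝ} {m : ℝ} (hH : ∀ s, m ≤ H s) (n : ℕ) (s : σ) :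
    m * ({w : Fin n → L | (List.ofFn w).foldlM f s ≠ none}.ncard : ℝ) ≤ runSum f H n s := by
  classical
  rw [Set.ncard_eq_toFinset_card', Set.toFinset_ofPred, Finset.card_filter, Nat.cast_sum,
    Finset.mul_sum]
  refine Finset.sum_le_sum fun w _ => ?_
  cases (List.ofFn w).foldlM f s with
  | none => simp
  | some t => simpa using hH t

theorem runSum_le_mul_ncard {H : σ → ℝ} {m : ℝ} (hH : ∀ s, H s ≤ m) (n : ℕ) (s : σ) :
    runSum f H n s ≤ m * ({w : Fin n → L | (List.ofFn w).foldlM f s ≠ none}.ncard : ℝ) := by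
  classical
  rw [Set.ncard_eq_toFinset_card', Set.toFinset_ofPred, Finset.card_filter, Nat.cast_sum,
    Finset.mul_sum]
  refine Finset.sum_le_sum fun w _ => ?_
  cases (List.ofFn w).foldlM f s with
  | none => simp
  | some t => simpa using hH t

end Counting

noncomputable instance {E : Type*} [Fintype E] : Fintype (Letter E) := Fintype.ofFinite _

theorem sum_letter {E : Type*} [Fintype E] (g : Letter E → ℝ) :
    ∑ l, g l = ∑ e, g (.neg e) + ∑ e, g (.pos e) := by
  let φ : E ⊕ E ≃ Letter E :=
    { toFun := Sum.elim Letter.neg Letter.pos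
      invFun := fun l => match l with
        | .neg e => .inl e
        | .pos e => .inr e
      left_inv := by rintro (e | e) <;> rfl
      right_inv := by rintro (e | e) <;> rfl }
  rw [← φ.sum_comp, Fintype.sum_sum_type]
  rfl

/-! ### Harmonic functions on stacks -/

namespace Stack

section Harmonic

variable {V E : Type*} (G : DirectedGraph V E) (p w b : V → ℝ)

/-- The weight of a stack with `H(v) = b_v` and `H(S e) = w_{r(e)} + p_{r(e)} H(S)`. -/
def weight : Stack V E → ℝ
  | base v => b v
  | push S e => w (G.r e) + p (G.r e) * S.weight

variable {G p w b}

theorem le_weight {m : ℝ} (hb : ∀ v, m ≤ b v) (hw : ∀ v, m ≤ w v + p v * m)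
    (hp : ∀ v, 0 < p v) (S : Stack V E) : m ≤ S.weight G p w b := by
  induction S with
  | base v => exact hb v
  | push S e ih =>
    exact (hw (G.r e)).trans (add_le_add_right (mul_le_mul_of_nonneg_left ih (hp _).le) _)

theorem weight_le {m : ℝ} (hb : ∀ v, b v ≤ m) (hw : ∀ v, w v + p v * m ≤ m)
    (hp : ∀ v, 0 < p v) (S : Stack V E) : S.weight G p w b ≤ m := by
  induction S with
  | base v => exact hb v
  | push S e ih =>
    exact le_trans (add_le_add_right (mul_le_mul_of_nonneg_left ih (hp _).le) _) (hw (G.r e))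

variable [Fintype E] [DecidableEq V] [DecidableEq E] {c : ℝ}

theorem sum_weight_step_neg (hc : ∀ v, ∑ e with G.s e = v, p (G.r e) + 1 / p v = c)
    (hw : ∀ v, ∑ e with G.s e = v, w (G.r e) = w v / p v) (S : Stack V E) :
    ∑ e, (S.step G (.neg e)).elim 0 (weight G p w b) =
      w (S.top G) / p (S.top G) + (c - 1 / p (S.top G)) * S.weight G p w b := by
  rw [← hw, ← hc (S.top G), add_sub_cancel_right, Finset.sum_mul, ← Finset.sum_add_distrib,
    Finset.sum_filter]
  refine Finset.sum_congr rfl fun e _ => ?_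
  rw [step_neg]
  split_ifs <;> rfl

/-- With `S` the stack below `f` and `v = r(f)`, pushes contribute `c H + (w_v - H) / p_v = c H -
H(S)`, and the single possible pop restores `H(S)`. -/
theorem sum_weight_step_push (hp : ∀ v, 0 < p v)
    (hc : ∀ v, ∑ e with G.s e = v, p (G.r e) + 1 / p v = c)
    (hw : ∀ v, ∑ e with G.s e = v, w (G.r e) = w v / p v) {S : Stack V E} {f : E}
    (hS : (push S f).Valid G) :
    ∑ l, ((push S f).step G l).elim 0 (weight G p w b) = c * (push S f).weight G p w b := by
  rw [sum_letter, sum_weight_step_neg hc hw]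
  have h : ∑ e, ((push S f).step G (.pos e)).elim 0 (weight G p w b) = S.weight G p w b := by
    rw [Finset.sum_eq_single f]
    · simp [step, hS.1]
    · intro e _ he
      simp [step, he.symm]
    · simp
  have h1 : p (G.r f) ≠ 0 := (hp _).ne'
  rw [h, top, weight]
  field_simp
  ring

theorem sum_weight_step_base (hc : ∀ v, ∑ e with G.s e = v, p (G.r e) + 1 / p v = c)
    (hw : ∀ v, ∑ e with G.s e = v, w (G.r e) = w v / p v) (v : V) :
    ∑ l, ((base v : Stack V E).step G l).elim 0 (weight G p w b) =
      w v / p v + (c - 1 / p v) * b v + ∑ e with G.r e = v, b (G.s e) := by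
  rw [sum_letter, sum_weight_step_neg hc hw, Finset.sum_filter]
  congr 1
  refine Finset.sum_congr rfl fun e _ => ?_
  rw [step]
  split_ifs <;> rfl

end Harmonic

/-! ### Bounds for the number of runs -/

section Bounds

variable {V E : Type*} [Fintype V] [Fintype E] [DecidableEq V] [DecidableEq E]
  {G : DirectedGraph V E} {p w θ : V → ℝ} {c : ℝ}

/-- With boundary values `b = w` the push terms on an empty stack already give `c * w`, and the base
moves only add. Since `p < 1`, the affine recursion keeps the weight bounded. -/
theorem exists_le_ncard_run (hp : ∀ v, 0 < p v) (hp1 : ∀ v, p v < 1) (hw0 : ∀ v, 0 < w v)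
    (hc0 : 0 ≤ c) (hc : ∀ v, ∑ e with G.s e = v, p (G.r e) + 1 / p v = c)
    (hw : ∀ v, ∑ e with G.s e = v, w (G.r e) = w v / p v) (v : V) :
    ∃ m > 0, ∀ n : ℕ, m * c ^ n ≤
      ({x : Fin n → Letter E | (base v).run G (List.ofFn x) ≠ none}.ncard : ℝ) := by
  -- The fixed point of `x ↦ w u + p u * x`; any `M` above all of them is preserved by the
  -- recursion.
  have h1 (u : V) : 0 < w u / (1 - p u) := div_pos (hw0 u) (sub_pos.2 (hp1 u))
  set M := ∑ u, w u / (1 - p u) with hM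
  have h2 (u : V) : w u / (1 - p u) ≤ M :=
    Finset.single_le_sum (f := fun u => w u / (1 - p u)) (fun u _ => (h1 u).le) (Finset.mem_univ u)
  have hM0 : 0 < M := (h1 v).trans_le (h2 v)
  have h3 (u : V) : w u + p u * M ≤ M := by
    have := (div_le_iff₀ (sub_pos.2 (hp1 u))).1 (h2 u)
    linarith
  have h4 (u : V) : w u ≤ M := by
    have := h3 u
    have := mul_pos (hp u) hM0
    linarith
  refine ⟨w v / M, div_pos (hw0 v) hM0, fun n => ?_⟩
  have hH : ∀ S : Stack V E, S.Valid G → c * S.weight G p w w ≤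
      ∑ l, (S.step G l).elim 0 (weight G p w w) := by
    intro S hS
    cases S with
    | base u =>
      rw [sum_weight_step_base hc hw, weight]
      have : 0 ≤ ∑ e with G.r e = u, w (G.s e) := Finset.sum_nonneg fun e _ => (hw0 _).le
      have h5 : w u / p u + (c - 1 / p u) * w u = c * w u := by ring
      linarith
    | push S f => exact (sum_weight_step_push hp hc hw hS).ge
  have key := (le_runSum (step G) (I := Valid G) (fun _ _ _ hS h => hS.step G h) hc0 hH n
    (s := base v) trivial).trans (runSum_le_mul_ncard (step G) (weight_le h4 h3 hp) n (base v))
  rw [div_mul_eq_mul_div, div_le_iff₀ hM0, mul_comm (w v), mul_comm _ M]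
  exact key

/-- With `b = θ` the base moves contribute `θ_v / p_v`, exactly what the pushes lack. The excess on
an empty stack is then only `w_v / p_v`, which is made small by rescaling `w`. -/
theorem exists_ncard_run_le (hp : ∀ v, 0 < p v) (hw0 : ∀ v, 0 < w v) (hθ0 : ∀ v, 0 < θ v)
    (hc0 : 0 ≤ c) (hc : ∀ v, ∑ e with G.s e = v, p (G.r e) + 1 / p v = c)
    (hw : ∀ v, ∑ e with G.s e = v, w (G.r e) = w v / p v)
    (hθ : ∀ v, ∑ e with G.r e = v, θ (G.s e) = θ v / p v) :
    ∃ K > 0, ∃ M > 0, ∀ n : ℕ, 1 ≤ n → ∀ v,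
      ({x : Fin n → Letter E | (base v).run G (List.ofFn x) ≠ none}.ncard : ℝ) ≤
        M * n * (c + K / n) ^ n := by
  set K := 1 + ∑ u, w u / (p u * θ u) with hK
  have hK1 (u : V) : 0 < w u / (p u * θ u) := div_pos (hw0 u) (mul_pos (hp u) (hθ0 u))
  have hK0 : 0 < K := add_pos_of_pos_of_nonneg one_pos (Finset.sum_nonneg fun u _ => (hK1 u).le)
  have hK2 (u : V) : w u / p u ≤ K * θ u := by
    have : w u / (p u * θ u) ≤ K := (Finset.single_le_sum (f := fun u => w u / (p u * θ u))
      (fun u _ => (hK1 u).le) (Finset.mem_univ u)).trans (le_add_of_nonneg_left zero_le_one)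
    rwa [← div_div, div_le_iff₀ (hθ0 u)] at this
  set D := 1 + ∑ u, (1 / w u + 1 / θ u) with hD
  have hD1 (u : V) : 0 ≤ 1 / w u + 1 / θ u :=
    add_nonneg (one_div_pos.2 (hw0 u)).le (one_div_pos.2 (hθ0 u)).le
  have hD0 : 0 < D := add_pos_of_pos_of_nonneg one_pos (Finset.sum_nonneg fun u _ => hD1 u)
  have hD2 (u : V) : 1 / w u + 1 / θ u ≤ D := (Finset.single_le_sum
    (f := fun u => 1 / w u + 1 / θ u) (fun u _ => hD1 u) (Finset.mem_univ u)).trans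
      (le_add_of_nonneg_left zero_le_one)
  have hDw (u : V) : 1 / D ≤ w u := by
    rw [one_div_le hD0 (hw0 u)]
    exact (le_add_of_nonneg_right (one_div_pos.2 (hθ0 u)).le).trans (hD2 u)
  have hDθ (u : V) : 1 / D ≤ θ u := by
    rw [one_div_le hD0 (hθ0 u)]
    exact (le_add_of_nonneg_left (one_div_pos.2 (hw0 u)).le).trans (hD2 u)
  set T := 1 + ∑ u, θ u with hT
  have hT0 : 0 < T := add_pos_of_pos_of_nonneg one_pos (Finset.sum_nonneg fun u _ => (hθ0 u).le)
  have hT2 (u : V) : θ u ≤ T := (Finset.single_le_sum (f := θ) (fun u _ => (hθ0 u).le)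
    (Finset.mem_univ u)).trans (le_add_of_nonneg_left zero_le_one)
  refine ⟨K, hK0, T * D, mul_pos hT0 hD0, fun n hn v => ?_⟩
  have hn0 : (1 : ℝ) ≤ n := by exact_mod_cast hn
  have hn1 : (0 : ℝ) < n := by linarith
  -- The equation for `w` is linear, so it survives the scaling. The relative excess drops to `K /
  -- n`, while the lower bound on the weight is still `1 / (D * n)`, a polynomial loss.
  set w' : V → ℝ := fun u => w u / n with hw'
  have hw'' (v : V) : ∑ e with G.s e = v, w' (G.r e) = w' v / p v := by
    rw [hw', ← Finset.sum_div, hw, div_right_comm]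
  have hlow : ∀ S : Stack V E, 1 / D / n ≤ S.weight G p w' θ := by
    have h0 : 0 < 1 / D / n := by positivity
    refine le_weight (fun u => ?_) (fun u => ?_) hp
    · exact (div_le_self (by positivity) hn0).trans (hDθ u)
    · refine (div_le_div_of_nonneg_right (hDw u) hn1.le).trans ?_
      exact le_add_of_nonneg_right (mul_pos (hp u) h0).le
  have hKn : 0 ≤ K / n := by positivity
  have hH : ∀ S : Stack V E, S.Valid G →
      ∑ l, (S.step G l).elim 0 (weight G p w' θ) ≤ (c + K / n) * S.weight G p w' θ := by
    intro S hS
    cases S with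
    | base u =>
      rw [sum_weight_step_base hc hw'', weight, hθ]
      have h5 : w' u / p u ≤ K / n * θ u := by
        rw [hw', div_right_comm, div_mul_eq_mul_div]
        exact div_le_div_of_nonneg_right (hK2 u) hn1.le
      have h6 : (c - 1 / p u) * θ u + θ u / p u = c * θ u := by ring
      linarith
    | push S f =>
      rw [sum_weight_step_push hp hc hw'' hS, add_mul]
      refine le_add_of_nonneg_right (mul_nonneg hKn (le_trans ?_ (hlow _)))
      positivity
  have key := (mul_ncard_le_runSum (step G) hlow n (base v)).trans (runSum_le (step G)
    (I := Valid G) (fun _ _ _ hS h => hS.step G h) (add_nonneg hc0 hKn) hH n (s := base v) trivial)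
  rw [div_div, one_div_mul_eq_div, div_le_iff₀ (mul_pos hD0 hn1)] at key
  calc _ ≤ (c + K / n) ^ n * θ v * (D * n) := key
    _ ≤ (c + K / n) ^ n * T * (D * n) := by gcongr; exact hT2 v
    _ = _ := by ring

end Bounds

end Stack

/-! ### Words of the shift -/

section Words

variable {V E : Type*} {G : DirectedGraph V E}

theorem window_add {A : Type*} (x : ℤ → A) (i : ℤ) (m n : ℕ) :
    window x i (m + n) = window x i m ++ window x (i + m) n := by
  simp [window, List.ofFn_add, add_assoc]

theorem admissible_of_mem_language {n : ℕ} {y : Fin n → Letter E} (h : y ∈ language (shift G) n) :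
    Admissible G (List.ofFn y) := by
  obtain ⟨x, hx, i, hi⟩ := h
  have : window x i n = List.ofFn y := by
    rw [window]
    congr 1
    exact funext hi
  exact this ▸ hx i n

variable [DecidableEq V] [DecidableEq E]

theorem Stack.run_replicate_pos {o : V} {f : E} (hs : G.s f = o) (hr : G.r f = o) (k : ℕ) :
    (base o).run G (List.replicate k (.pos f)) = some (base o) := by
  induction k with
  | zero => rfl
  | succ k ih => simpa [List.replicate_succ, step, hs, hr] using ih

theorem Stack.run_replicate_neg {o : V} {f : E} (hs : G.s f = o) (hr : G.r f = o) (k : ℕ)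
    {S : Stack V E} (hS : S.top G = o) : S.run G (List.replicate k (.neg f)) ≠ none := by
  induction k generalizing S with
  | zero => simp
  | succ k ih =>
    simp only [List.replicate_succ, run_cons, step_neg, hs, hS, if_true, Option.bind_some]
    exact ih (S := push S f) hr

/-- The word is extended to a point: the loop letter `f⁺` forever on the left keeps the stack empty
at `o`; on the right, `g⁻` leads back to `o` and `f⁻` is then pushed forever. -/
theorem mem_language_of_run {o : V} {f : E} (hs : G.s f = o) (hr : G.r f = o)
    (ho : ∀ v, ∃ e, G.s e = v ∧ G.r e = o) {n : ℕ} {y : Fin n → Letter E}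
    (h : (Stack.base o).run G (List.ofFn y) ≠ none) : y ∈ language (shift G) n := by
  obtain ⟨S, hS⟩ := Option.ne_none_iff_exists'.1 h
  obtain ⟨g, hgs, hgr⟩ := ho (S.top G)
  set x : ℤ → Letter E := fun i =>
    if i < 0 then .pos f else
      if hi : i.toNat < n then y ⟨i.toNat, hi⟩ else if i = n then .neg g else .neg f with hx
  have hy : window x 0 n = List.ofFn y := by
    rw [window]
    congr 1
    funext k
    simp [hx]
  refine ⟨x, fun i m => ?_, 0, fun k => by simp [hx]⟩
  obtain ⟨K, hK⟩ : ∃ K : ℕ, 0 ≤ i + K := ⟨(-i).toNat, by omega⟩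
  obtain ⟨j, hj⟩ := Int.eq_ofNat_of_zero_le hK
  have h1 : window x (-K) K = List.replicate K (.pos f) := by
    rw [window, ← List.ofFn_const]
    congr 1
    funext k
    have : -(K : ℤ) + (k : ℤ) < 0 := by have := k.2; omega
    simp [hx, this]
  have h2 (M : ℕ) : window x (0 + n) (1 + M) = .neg g :: List.replicate M (.neg f) := by
    rw [window_add, window, window, ← List.ofFn_const]
    simp only [List.ofFn_succ, List.ofFn_zero, List.cons_append, List.nil_append]
    congr 1
    · simp [hx]
    · congr 1
      funext k
      have h3 : ¬ (0 + (n : ℤ) + ((1 : ℕ) : ℤ) + (k : ℤ) < 0) := by omega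
      have h4 : ¬ ((0 + (n : ℤ) + ((1 : ℕ) : ℤ) + (k : ℤ)).toNat < n) := by omega
      have h5 : ¬ (0 + (n : ℤ) + ((1 : ℕ) : ℤ) + (k : ℤ) = n) := by omega
      simp only [hx, h3, h4, h5, if_false, dif_neg, not_false_eq_true]
  -- This window starts at or before `i` and is long enough to contain the given one, whatever its
  -- position.
  have key : (Stack.base o).run G (window x (-K) (K + (n + (1 + (j + m))))) ≠ none := by
    rw [window_add, window_add, h1, neg_add_cancel, hy, h2, Stack.run_append,
      Stack.run_replicate_pos hs hr, Option.bind_some, Stack.run_append, hS, Option.bind_some,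
      Stack.run_cons, Stack.step_neg, if_pos hgs, Option.bind_some]
    exact Stack.run_replicate_neg hs hr _ hgr
  have hsplit : window x (-K) (K + (n + (1 + (j + m)))) =
      window x (-K) j ++ (window x i m ++ window x (i + m) (K + n + 1)) := by
    rw [show K + (n + (1 + (j + m))) = j + (m + (K + n + 1)) by ring, window_add, window_add]
    rw [show -(K : ℤ) + j = i by omega]
  rw [hsplit] at key
  exact (Stack.admissible_of_run_ne_none G key).of_append

end Words

/-! ### From counting bounds to entropy -/

theorem hasEntropy_log_of_bounds {A : Type*} [TopologicalSpace A] [Finite A] {X : ZSubshift A}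
    {c m M K : ℝ} (hc : 0 < c) (hm : 0 < m) (hM : 0 < M) (hK : 0 < K)
    (hl : ∀ n : ℕ, m * c ^ n ≤ (language X n).ncard)
    (hu : ∀ n : ℕ, 1 ≤ n → ((language X n).ncard : ℝ) ≤ M * n * (c + K / n) ^ n) :
    HasEntropy X (Real.log c) := by
  have hinv : Tendsto (fun n : ℕ => 1 / (n : ℝ)) atTop (𝓝 0) := tendsto_one_div_atTop_nhds_zero_nat
  have hlog : Tendsto (fun n : ℕ => Real.log n / (n : ℝ)) atTop (𝓝 0) :=
    (Real.isLittleO_log_id_atTop.tendsto_div_nhds_zero).comp tendsto_natCast_atTop_atTop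
  have hL : Tendsto (fun n : ℕ => 1 / (n : ℝ) * Real.log m + Real.log c) atTop
      (𝓝 (Real.log c)) := by
    simpa using (hinv.mul_const (Real.log m)).add_const (Real.log c)
  have hU : Tendsto (fun n : ℕ => 1 / (n : ℝ) * Real.log M + Real.log n / (n : ℝ) +
      Real.log (c + K * (1 / n))) atTop (𝓝 (Real.log c)) := by
    have h1 : Tendsto (fun n : ℕ => c + K * (1 / (n : ℝ))) atTop (𝓝 c) := by
      simpa using (hinv.const_mul K).const_add c
    simpa using ((hinv.mul_const (Real.log M)).add hlog).add (h1.log hc.ne')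
  refine tendsto_of_tendsto_of_tendsto_of_le_of_le' hL hU ?_ ?_
  · filter_upwards [eventually_ge_atTop 1] with n hn
    have hn1 : (0 : ℝ) < n := by exact_mod_cast hn
    have h := Real.log_le_log (by positivity) (hl n)
    rw [Real.log_mul hm.ne' (by positivity), Real.log_pow] at h
    calc 1 / (n : ℝ) * Real.log m + Real.log c
        = 1 / n * (Real.log m + n * Real.log c) := by field_simp
      _ ≤ _ := by gcongr
  · filter_upwards [eventually_ge_atTop 1] with n hn
    have hn1 : (0 : ℝ) < n := by exact_mod_cast hn
    have hpos : (0 : ℝ) < (language X n).ncard := lt_of_lt_of_le (by positivity) (hl n)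
    have h := Real.log_le_log hpos (hu n hn)
    rw [Real.log_mul (by positivity) (by positivity), Real.log_mul hM.ne' hn1.ne',
      Real.log_pow] at h
    calc _ ≤ 1 / (n : ℝ) * (Real.log M + Real.log n + n * Real.log (c + K / n)) := by gcongr
      _ = _ := by rw [mul_one_div]; field_simp

/-- The entropy of a Markov-Dyck shift from a positive solution `p` of the equations
`∑_{s(e) = v} p_{r(e)} + 1 / p_v = c`, for which the matrix with the rows of the adjacency matrix
multiplied by `p_v` has the eigenvalue `1` with positive left and right eigenvectors. -/
theorem hasEntropy_shift {V E : Type*} [Fintype V] [Fintype E] [DecidableEq V]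
    {G : DirectedGraph V E} {p w θ : V → ℝ} {c : ℝ} (hp : ∀ v, 0 < p v) (hp1 : ∀ v, p v < 1)
    (hw0 : ∀ v, 0 < w v) (hθ0 : ∀ v, 0 < θ v) (hc0 : 0 < c)
    (hc : ∀ v, ∑ e with G.s e = v, p (G.r e) + 1 / p v = c)
    (hw : ∀ v, ∑ e with G.s e = v, w (G.r e) = w v / p v)
    (hθ : ∀ v, ∑ e with G.r e = v, θ (G.s e) = θ v / p v)
    (o : V) (ho : ∀ v, ∃ e, G.s e = v ∧ G.r e = o) :
    HasEntropy (shift G) (Real.log c) := by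
  classical
  obtain ⟨f, hs, hr⟩ := ho o
  obtain ⟨m, hm, hl⟩ := Stack.exists_le_ncard_run hp hp1 hw0 hc0.le hc hw o
  obtain ⟨K, hK, M, hM, hu⟩ := Stack.exists_ncard_run_le hp hw0 hθ0 hc0.le hc hw hθ
  have hV : (0 : ℝ) < Fintype.card V := by exact_mod_cast Fintype.card_pos_iff.2 ⟨o⟩
  refine hasEntropy_log_of_bounds hc0 hm (mul_pos hV hM) hK (fun n => (hl n).trans ?_)
    fun n hn => ?_
  · exact_mod_cast Set.ncard_le_ncard (fun y hy => mem_language_of_run hs hr ho hy)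
  · have h1 : language (shift G) n ⊆ ⋃ v, {x : Fin n → Letter E |
        (Stack.base v).run G (List.ofFn x) ≠ none} := by
      intro y hy
      have hne : List.ofFn y ≠ [] := by
        rw [Ne, List.ofFn_eq_nil_iff]
        omega
      exact Set.mem_iUnion.2 (exists_run_base_ne_none G hne (admissible_of_mem_language hy))
    have h2 := (Set.ncard_le_ncard h1).trans (Set.ncard_iUnion_le_of_fintype _)
    calc ((language (shift G) n).ncard : ℝ)
        ≤ ∑ v, ({x : Fin n → Letter E |
          (Stack.base v).run G (List.ofFn x) ≠ none}.ncard : ℝ) := by exact_mod_cast h2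
      _ ≤ ∑ _v : V, M * n * (c + K / n) ^ n := Finset.sum_le_sum fun v _ => hu n hn v
      _ = Fintype.card V * M * n * (c + K / n) ^ n := by simp; ring

/-! ### Sums over edges and the adjacency matrix -/

section Adjacency

variable {V E : Type*} [Fintype E] [DecidableEq V] (G : DirectedGraph V E)

theorem DirectedGraph.adjacency_eq_card (u v : V) :
    G.adjacency u v = (Finset.univ.filter fun e => G.s e = u ∧ G.r e = v).card := by
  rw [adjacency, Matrix.of_apply, Nat.card_eq_fintype_card, Fintype.card_subtype]

theorem DirectedGraph.sum_source [Fintype V] (g : V → ℝ) (v : V) :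
    ∑ e with G.s e = v, g (G.r e) = ∑ u, (G.adjacency v u : ℝ) * g u := by
  rw [← Finset.sum_fiberwise (g := G.r)]
  refine Finset.sum_congr rfl fun u _ => ?_
  rw [Finset.filter_filter, adjacency_eq_card, ← nsmul_eq_mul, ← Finset.sum_const]
  exact Finset.sum_congr rfl fun e he => by rw [(Finset.mem_filter.1 he).2.2]

theorem DirectedGraph.sum_range [Fintype V] (g : V → ℝ) (v : V) :
    ∑ e with G.r e = v, g (G.s e) = ∑ u, (G.adjacency u v : ℝ) * g u := by
  rw [← Finset.sum_fiberwise (g := G.s)]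
  refine Finset.sum_congr rfl fun u _ => ?_
  rw [Finset.filter_filter, adjacency_eq_card, ← nsmul_eq_mul, ← Finset.sum_const]
  simp only [and_comm (a := G.r _ = v)]
  exact Finset.sum_congr rfl fun e he => by rw [(Finset.mem_filter.1 he).2.1]

theorem DirectedGraph.exists_edge {u v : V} (h : G.adjacency u v ≠ 0) :
    ∃ e, G.s e = u ∧ G.r e = v := by
  rw [adjacency_eq_card] at h
  obtain ⟨e, he⟩ := Finset.card_ne_zero.1 h
  exact ⟨e, (Finset.mem_filter.1 he).2⟩

end Adjacency

/-! ### The graphs with adjacency matrix `F(a,1,a)` -/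

/-- Equating the two values of `c` gives `p₁ + 1/p₀ = 1/p₁`, and eigenvalue `1` means `a p₀ (1 + p₁)
= 1`. The solution is `p₁ = 1/(a+1)`, `p₀ = (a+1)/(a(a+2))`, whence `c = a p₀ + 1/p₁ =
(a+1)(a+3)/(a+2)`. -/
theorem hasEntropy_shift_F {E : Type*} [Fintype E] {a : ℕ} (ha : 1 ≤ a)
    {G : DirectedGraph (Fin 2) E} (hG : G.adjacency = F a 1 a) :
    HasEntropy (shift G) (Real.log (((a : ℝ) + 1) * (a + 3) / (a + 2))) := by
  have ha1 : (1 : ℝ) ≤ a := by exact_mod_cast ha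
  have ha0 : (0 : ℝ) < a := by linarith
  refine hasEntropy_shift (p := ![((a : ℝ) + 1) / (a * (a + 2)), 1 / ((a : ℝ) + 1)])
    (w := ![(a : ℝ) + 1, a]) (θ := ![(a : ℝ) + 1, 1]) ?_ ?_ ?_ ?_ (by positivity) ?_ ?_ ?_ 0 ?_
  · intro v
    fin_cases v <;> simp <;> positivity
  · intro v
    fin_cases v
    · change ((a : ℝ) + 1) / (a * (a + 2)) < 1
      rw [div_lt_one (by positivity)]
      nlinarith
    · change 1 / ((a : ℝ) + 1) < 1
      rw [div_lt_one (by positivity)]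
      linarith
  · intro v
    fin_cases v <;> simp <;> positivity
  · intro v
    fin_cases v <;> simp; positivity
  · intro v
    rw [G.sum_source, hG]
    fin_cases v <;> simp [F, Fin.sum_univ_two] <;> field_simp <;> ring
  · intro v
    rw [G.sum_source, hG]
    fin_cases v <;> simp [F, Fin.sum_univ_two] <;> field_simp <;> ring
  · intro v
    rw [G.sum_range, hG]
    fin_cases v <;> simp [F, Fin.sum_univ_two] <;> field_simp <;> ring
  · intro v
    apply G.exists_edge
    rw [hG]
    fin_cases v <;> simp [F] <;> omega

end MarkovDyck

theorem mainTheorem6 {E : Type*} [Fintype E] (a : ℕ) (ha : 1 ≤ a)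
    (G : MarkovDyck.DirectedGraph (Fin 2) E) (hG : G.adjacency = MarkovDyck.F a 1 a) :
    MarkovDyck.HasEntropy (MarkovDyck.shift G)
        (Real.log ((a : ℝ) + 1) - Real.log ((a : ℝ) + 2) + Real.log ((a : ℝ) + 3)) ∧
      (a = 1 →
        MarkovDyck.HasEntropy (MarkovDyck.shift G) (3 * Real.log 2 - Real.log 3)) := by
  have h := MarkovDyck.hasEntropy_shift_F ha hG
  rw [Real.log_div (by positivity) (by positivity), Real.log_mul (by positivity) (by positivity),
    add_sub_right_comm] at h
  refine ⟨h, ?_⟩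
  rintro rfl
  convert h using 1
  have h4 : Real.log 4 = 2 * Real.log 2 := by
    rw [show (4 : ℝ) = 2 ^ 2 by norm_num, Real.log_pow]
    norm_num
  norm_num
  linarith
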